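/- Let $S$ be a numerical semigroup (a submonoid of $\mathbb N=\{0,1,2,\dots\}$ with finite complement) minimally generated by the $p\ge 2$ distinct elements $n_1,\dots,n_p$, i.e. these generate $S$ and no proper subset of $\{n_1,\dots,n_p\}$ generates $S$. Let $\pi:\mathbb N^p\to S$, $\pi(u)=\sum_i u_i n_i$. A presentation of $S$ is a set $\sigma\subseteq\mathbb N^p\times\mathbb N^p$ such that the least congruence on $\mathbb N^p$ containing $\sigma$ is $\{(u,v)\mid \pi(u)=\pi(v)\}$; it is minimal if no proper subset of it is a presentation. Let $\mathrm{Betti}(S)$ be the set of all $\pi(u)$ with $(u,v)\in\sigma$ for a minimal presentation $\sigma$ of $S$ (this set does not depend on the choice of $\sigma$). For $i=1,\dots,p$ let $$c_i=\min\{m\in\mathbb N\setminus\{0\}\mid m\,n_i\in\langle n_j \mid j\ne i\rangle\},$$ where $\langle\cdot\rangle$ denotes the generated submonoid of $\mathbb N$. Then the following are equivalent: 1. $\mathrm{Betti}(S)$ is a singleton. 2. There exist pairwise relatively prime integers $k_1,\dots,k_p$, all greater than $1$, such that $n_i=\prod_{j\neq i}k_j$ for all $i\in\{1,\dots,p\}$.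 Furthermore, in this case, for any $k_1,\dots,k_p$ as in (2), $k_i=c_i$ for all $i\in\{1,\dots,p\}$, and $\mathrm{Betti}(S)=\{c_1n_1\}=\{c_in_i\mid i\in\{1,\dots,p\}\}$ (so all the $c_in_i$ are equal). -/

import Mathlib

/-- A numerical semigroup: a submonoid of `ℕ` with finite complement. -/
def IsNumericalSemigroup (S : AddSubmonoid ℕ) : Prop :=
  ((S : Set ℕ)ᶜ).Finite

/-- The (distinct) elements `a i` generate the monoid `S`, and no proper subset of
`{a i | i}` generates `S`. -/
structure IsMinimallyGeneratedBy {ι M : Type*} [AddCommMonoid M]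
    (S : AddSubmonoid M) (a : ι → M) : Prop where
  injective : Function.Injective a
  closure_range : AddSubmonoid.closure (Set.range a) = S
  minimal : ∀ T : Set M, T ⊂ Set.range a → AddSubmonoid.closure T ≠ S

/-- The factorization homomorphism `u ↦ ∑ i, u i • a i` associated to the generators `a`. -/
def factorizationHom {ι M : Type*} [Fintype ι] [AddCommMonoid M] (a : ι → M) :
    (ι → ℕ) →+ M where
  toFun u := ∑ i, u i • a i
  map_zero' := by simp
  map_add' u v := by simp [add_smul, Finset.sum_add_distrib]

/-- `σ` is a presentation of the monoid generated by `a`: the kernel congruence of the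
factorization homomorphism is the least congruence containing `σ`. -/
def IsPresentation {ι M : Type*} [Fintype ι] [AddCommMonoid M] (a : ι → M)
    (σ : Set ((ι → ℕ) × (ι → ℕ))) : Prop :=
  addConGen (fun u v => (u, v) ∈ σ) = AddCon.ker (factorizationHom a)

/-- A minimal presentation: a presentation none of whose proper subsets is a presentation. -/
def IsMinimalPresentation {ι M : Type*} [Fintype ι] [AddCommMonoid M] (a : ι → M)
    (σ : Set ((ι → ℕ) × (ι → ℕ))) : Prop :=
  IsPresentation a σ ∧ ∀ τ, τ ⊂ σ → ¬ IsPresentation a τ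

/-- The set of Betti elements of the monoid minimally generated by `a`: the elements whose
factorizations occur in the relations of a minimal presentation. (For an affine semigroup the
set of these elements is the same for each minimal presentation.) -/
def bettiElements {ι M : Type*} [Fintype ι] [AddCommMonoid M] (a : ι → M) : Set M :=
  {b | ∃ σ, IsMinimalPresentation a σ ∧ ∃ u v, (u, v) ∈ σ ∧ factorizationHom a u = b}

/-- `c i`: the least positive integer `m` such that `m * n i` lies in the monoid generated by
the other generators `n j`, `j ≠ i`. -/
noncomputable def leastMultiplier {ι : Type*} (n : ι → ℕ) (i : ι) : ℕ :=
  sInf {m : ℕ | 0 < m ∧ m * n i ∈ AddSubmonoid.closure (n '' {j | j ≠ i})}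

/-- The `k i` are pairwise coprime integers greater than one, and `n i` is the product of the
`k j` with `j ≠ i`. -/
def IsCoprimeProductForm {ι : Type*} [Fintype ι] [DecidableEq ι] (n k : ι → ℕ) : Prop :=
  (∀ i, 1 < k i) ∧ (∀ i j, i ≠ j → Nat.Coprime (k i) (k j)) ∧
    ∀ i, n i = ∏ j ∈ Finset.univ.erase i, k j

/-! If every relation of a presentation has value `d`, factorizations below `d` are unique, which
forces `c i * n i = d`. A factorization of `d` using the atom `i` must be `c i` copies of it: remove
one copy and apply uniqueness. So values determine coordinates mod `c i`
(`modEq_of_factorizationHom_eq`). Factoring two consecutive elements of `S` then gives an integer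
factorization of 1, from which `isCoprimeProductForm_of_modEq` reads off coprimality and the product
formula. Conversely, for coprime products the value fixes each coordinate mod `k i`, hence also the
total number of batches of `k i` copies of `n i`, each worth `∏ j, k j`. Exchanging batches thus
generates all relations, and these exchanges all have value `∏ j, k j`. -/

section Factorization

variable {ι : Type*} [Fintype ι]

lemma factorizationHom_apply (n u : ι → ℕ) : factorizationHom n u = ∑ i, u i * n i := by
  simp [factorizationHom]

lemma factorizationHom_single [DecidableEq ι] (n : ι → ℕ) (i : ι) (m : ℕ) :
    factorizationHom n (Pi.single i m) = m * n i := by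
  rw [factorizationHom_apply, Finset.sum_eq_single i]
  · simp
  · intro j _ hj
    simp [hj]
  · simp

lemma mul_le_factorizationHom (n u : ι → ℕ) (i : ι) : u i * n i ≤ factorizationHom n u := by
  rw [factorizationHom_apply]
  exact Finset.single_le_sum (f := fun j => u j * n j) (fun _ _ => Nat.zero_le _)
    (Finset.mem_univ i)

lemma eq_zero_of_factorizationHom_eq_zero {n : ι → ℕ} (hpos : ∀ i, 0 < n i) {u : ι → ℕ}
    (hu : factorizationHom n u = 0) : u = 0 := by
  funext i
  have h := mul_le_factorizationHom n u i
  rw [hu, Nat.le_zero, Nat.mul_eq_zero] at h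
  exact h.resolve_right (hpos i).ne'

lemma mem_closure_range_iff_exists_factorizationHom (n : ι → ℕ) (x : ℕ) :
    x ∈ AddSubmonoid.closure (Set.range n) ↔ ∃ u, factorizationHom n u = x := by
  classical
  constructor
  · intro hx
    have hle : AddSubmonoid.closure (Set.range n) ≤ AddMonoidHom.mrange (factorizationHom n) := by
      rw [AddSubmonoid.closure_le]
      rintro _ ⟨i, rfl⟩
      exact ⟨Pi.single i 1, by simp [factorizationHom_single]⟩
    exact hle hx
  · rintro ⟨u, rfl⟩
    rw [factorizationHom_apply]
    refine AddSubmonoid.sum_mem _ fun i _ => ?_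
    rw [← smul_eq_mul]
    exact AddSubmonoid.nsmul_mem _ (AddSubmonoid.subset_closure (Set.mem_range_self i)) _

lemma mem_closure_image_ne_iff (n : ι → ℕ) (i : ι) (x : ℕ) :
    x ∈ AddSubmonoid.closure (n '' {j | j ≠ i}) ↔ ∃ u, u i = 0 ∧ factorizationHom n u = x := by
  classical
  constructor
  · intro hx
    have hle : AddSubmonoid.closure (n '' {j | j ≠ i}) ≤
        (AddMonoidHom.mker (Pi.evalAddMonoidHom (fun _ : ι => ℕ) i)).map
          (factorizationHom n) := by
      rw [AddSubmonoid.closure_le]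
      rintro _ ⟨j, hj, rfl⟩
      refine ⟨Pi.single j 1, ?_, by simp [factorizationHom_single]⟩
      have hij : i ≠ j := fun h => hj h.symm
      simp [AddMonoidHom.mem_mker, hij]
    obtain ⟨u, hu, rfl⟩ := hle hx
    exact ⟨u, hu, rfl⟩
  · rintro ⟨u, hu, rfl⟩
    rw [factorizationHom_apply]
    refine AddSubmonoid.sum_mem _ fun j _ => ?_
    by_cases hj : j = i
    · subst hj
      simp [hu]
    · rw [← smul_eq_mul]
      exact AddSubmonoid.nsmul_mem _ (AddSubmonoid.subset_closure (Set.mem_image_of_mem n hj)) _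

end Factorization

section MinimalGenerators

variable {ι : Type*} {S : AddSubmonoid ℕ} {n : ι → ℕ}

lemma IsMinimallyGeneratedBy.notMem_closure (hn : IsMinimallyGeneratedBy S n) (i : ι) :
    n i ∉ AddSubmonoid.closure (n '' {j | j ≠ i}) := by
  intro hi
  refine hn.minimal (n '' {j | j ≠ i}) ⟨Set.image_subset_range _ _, fun h => ?_⟩ ?_
  · obtain ⟨j, hj, hji⟩ := h ⟨i, rfl⟩
    exact hj (hn.injective hji)
  · refine le_antisymm ?_ ?_
    · rw [← hn.closure_range]
      exact AddSubmonoid.closure_mono (Set.image_subset_range _ _)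
    · rw [← hn.closure_range, AddSubmonoid.closure_le]
      rintro _ ⟨j, rfl⟩
      by_cases hj : j = i
      · rw [hj]
        exact hi
      · exact AddSubmonoid.subset_closure (Set.mem_image_of_mem n hj)

lemma IsMinimallyGeneratedBy.pos (hn : IsMinimallyGeneratedBy S n) (i : ι) : 0 < n i := by
  refine Nat.pos_of_ne_zero fun h => hn.notMem_closure i ?_
  rw [h]
  exact zero_mem _

lemma leastMultiplier_mem [Nontrivial ι] (hpos : ∀ i, 0 < n i) (i : ι) :
    0 < leastMultiplier n i ∧
      leastMultiplier n i * n i ∈ AddSubmonoid.closure (n '' {j | j ≠ i}) := by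
  obtain ⟨j, hj⟩ := exists_ne i
  refine Nat.sInf_mem (s := {m : ℕ | 0 < m ∧
    m * n i ∈ AddSubmonoid.closure (n '' {j | j ≠ i})}) ⟨n j, hpos j, ?_⟩
  rw [mul_comm, ← smul_eq_mul]
  exact AddSubmonoid.nsmul_mem _ (AddSubmonoid.subset_closure (Set.mem_image_of_mem n hj)) _

lemma leastMultiplier_le {i : ι} {m : ℕ} (hm : 0 < m)
    (h : m * n i ∈ AddSubmonoid.closure (n '' {j | j ≠ i})) : leastMultiplier n i ≤ m :=
  Nat.sInf_le ⟨hm, h⟩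

lemma IsMinimallyGeneratedBy.one_lt_leastMultiplier [Nontrivial ι]
    (hn : IsMinimallyGeneratedBy S n) (i : ι) : 1 < leastMultiplier n i := by
  obtain ⟨h0, h⟩ := leastMultiplier_mem hn.pos i
  refine lt_of_le_of_ne h0 fun h1 => hn.notMem_closure i ?_
  rwa [← h1, one_mul] at h

end MinimalGenerators

/-! ### Rewriting by the relations of a presentation -/

section Presentation

variable {ι : Type*} [Fintype ι] {n : ι → ℕ} {σ : Set ((ι → ℕ) × (ι → ℕ))}

lemma IsPresentation.factorizationHom_eq (h : IsPresentation n σ) {u v : ι → ℕ}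
    (huv : (u, v) ∈ σ) : factorizationHom n u = factorizationHom n v := by
  have : addConGen (fun u v => (u, v) ∈ σ) u v := AddConGen.Rel.of _ _ huv
  rw [h] at this
  exact (AddCon.ker_rel _).mp this

/-- A congruence containing a presentation contains all pairs with equal images. -/
lemma IsPresentation.rel_of_le (h : IsPresentation n σ) (C : AddCon (ι → ℕ))
    (hC : ∀ u v, (u, v) ∈ σ → C u v) {u v : ι → ℕ}
    (huv : factorizationHom n u = factorizationHom n v) : C u v := by
  have hle : AddCon.ker (factorizationHom n) ≤ C := by
    rw [← h]
    exact AddCon.addConGen_le.mpr hC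
  exact hle ((AddCon.ker_rel _).mpr huv)

/-- For an ideal `A`, the congruence identifying all elements of `A`. -/
def idealAddCon {M : Type*} [AddCommMonoid M] (A : Set M) (hA : ∀ a ∈ A, ∀ w, a + w ∈ A) :
    AddCon M where
  r u v := u = v ∨ (u ∈ A ∧ v ∈ A)
  iseqv := by
    refine ⟨fun _ => Or.inl rfl, ?_, ?_⟩
    · rintro u v (rfl | h)
      · exact Or.inl rfl
      · exact Or.inr h.symm
    · rintro u v w (rfl | h) (rfl | h')
      · exact Or.inl rfl
      · exact Or.inr h'
      · exact Or.inr h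
      · exact Or.inr ⟨h.1, h'.2⟩
  add' := by
    rintro u v u' v' (rfl | h) (rfl | h')
    · exact Or.inl rfl
    · refine Or.inr ⟨?_, ?_⟩
      · rw [add_comm]
        exact hA _ h'.1 _
      · rw [add_comm]
        exact hA _ h'.2 _
    · exact Or.inr ⟨hA _ h.1 _, hA _ h.2 _⟩
    · exact Or.inr ⟨hA _ h.1 _, hA _ h.2 _⟩

/-- An element with two factorizations is nontrivially rewritten by a relation of any
presentation. -/
lemma IsPresentation.exists_relation (h : IsPresentation n σ) {u v : ι → ℕ}
    (huv : factorizationHom n u = factorizationHom n v) (hne : u ≠ v) :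
    ∃ a b w, ((a, b) ∈ σ ∨ (b, a) ∈ σ) ∧ a ≠ b ∧ u = a + w := by
  -- `A` is the ideal generated by the endpoints of nontrivial relations; collapsing it to a point
  -- respects `σ`.
  let A : Set (ι → ℕ) := {u | ∃ a b w, ((a, b) ∈ σ ∨ (b, a) ∈ σ) ∧ a ≠ b ∧ u = a + w}
  have hA : ∀ a ∈ A, ∀ w, a + w ∈ A := by
    rintro _ ⟨a, b, w, hab, hne, rfl⟩ w'
    exact ⟨a, b, w + w', hab, hne, add_assoc _ _ _⟩
  have hrel : idealAddCon A hA u v := by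
    refine h.rel_of_le _ (fun a b hab => ?_) huv
    by_cases hne : a = b
    · exact Or.inl hne
    · exact Or.inr ⟨⟨a, b, 0, Or.inl hab, hne, (add_zero a).symm⟩,
        ⟨b, a, 0, Or.inr hab, Ne.symm hne, (add_zero b).symm⟩⟩
  rcases hrel with h | h
  · exact absurd h hne
  · exact h.1

/-- A rewritable vector lies above an endpoint of value `d`, so its own value is at least `d`. -/
lemma IsPresentation.factorizationHom_injOn_lt {d : ℕ}
    (h : IsPresentation n σ) (hd : ∀ u v, (u, v) ∈ σ → factorizationHom n u = d) {u v : ι → ℕ}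
    (huv : factorizationHom n u = factorizationHom n v) (hu : factorizationHom n u < d) :
    u = v := by
  by_contra hne
  obtain ⟨a, b, w, hab, -, rfl⟩ := h.exists_relation huv hne
  have ha : factorizationHom n a = d := by
    rcases hab with hab | hab
    · exact hd _ _ hab
    · rw [← h.factorizationHom_eq hab, hd _ _ hab]
  rw [map_add, ha] at hu
  omega

/-- Congruence of the `i`-th coordinates modulo `c i`, for every `i`. -/
def coordModAddCon {ι : Type*} (c : ι → ℕ) : AddCon (ι → ℕ) where
  r u v := ∀ i, u i ≡ v i [MOD c i]
  iseqv := ⟨fun _ _ => rfl, fun h i => (h i).symm, fun h h' i => (h i).trans (h' i)⟩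
  add' h h' i := (h i).add (h' i)

lemma exists_isMinimalPresentation_subset (hfin : σ.Finite) (h : IsPresentation n σ) :
    ∃ τ ⊆ σ, IsMinimalPresentation n τ := by
  have hF : {τ | τ ⊆ σ ∧ IsPresentation n τ}.Finite :=
    hfin.finite_subsets.subset fun τ hτ => hτ.1
  obtain ⟨τ, hτ⟩ := hF.exists_minimal ⟨σ, subset_rfl, h⟩
  refine ⟨τ, hτ.prop.1, hτ.prop.2, fun ρ hρ hpres => ?_⟩
  exact hρ.2 (hτ.2 ⟨hρ.1.trans hτ.prop.1, hpres⟩ hρ.1)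

end Presentation

/-! ### Presentations with all relations in one degree -/

section HomogeneousPresentation

variable {ι : Type*} [Fintype ι] [DecidableEq ι] {n : ι → ℕ} {d : ℕ}
  {σ : Set ((ι → ℕ) × (ι → ℕ))}

/-- A relation rewriting `c i` copies of the atom `i` has an endpoint `a` supported at `i`.
Cancelling the copies of `i` in the other endpoint `b` leaves a positive multiple `a i - b i ≤ c i`,
so minimality of `c i` gives `a i = c i`. -/
lemma IsPresentation.leastMultiplier_mul_eq [Nontrivial ι] (hpos : ∀ i, 0 < n i)
    (h : IsPresentation n σ) (hd : ∀ u v, (u, v) ∈ σ → factorizationHom n u = d) (i : ι) :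
    leastMultiplier n i * n i = d := by
  obtain ⟨hc0, hc⟩ := leastMultiplier_mem hpos i
  obtain ⟨v, hv0, hv⟩ := (mem_closure_image_ne_iff n i _).mp hc
  obtain ⟨a, b, w, hab, hne, haw⟩ :=
    h.exists_relation (u := Pi.single i (leastMultiplier n i)) (v := v)
      (by rw [factorizationHom_single, hv])
      (fun he => by
        have := congrFun he i
        rw [Pi.single_eq_same, hv0] at this
        omega)
  have hπ : factorizationHom n a = d ∧ factorizationHom n b = d := by
    rcases hab with hab | hab
    · exact ⟨hd _ _ hab, by rw [← h.factorizationHom_eq hab, hd _ _ hab]⟩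
    · exact ⟨by rw [← h.factorizationHom_eq hab, hd _ _ hab], hd _ _ hab⟩
  have ha : a = Pi.single i (a i) := by
    funext j
    by_cases hj : j = i
    · subst hj
      simp
    · have := congrFun haw j
      simp only [Pi.single_eq_of_ne hj, Pi.add_apply] at this ⊢
      omega
  have hai : a i ≤ leastMultiplier n i := by
    have := congrFun haw i
    simp only [Pi.single_eq_same, Pi.add_apply] at this
    omega
  have hdai : d = a i * n i := by
    rw [← hπ.1]
    conv_lhs => rw [ha]
    exact factorizationHom_single n i (a i)
  have hsplit : b = Pi.single i (b i) + Function.update b i 0 := by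
    funext j
    by_cases hj : j = i
    · subst hj
      simp
    · simp [hj]
  have hsum : b i * n i + factorizationHom n (Function.update b i 0) = a i * n i := by
    rw [← hdai, ← hπ.2]
    conv_rhs => rw [hsplit]
    rw [map_add, factorizationHom_single]
  -- Otherwise the part of `b` away from `i` has value 0, hence vanishes, and `a = b`.
  have hlt : b i < a i := by
    by_contra! hle
    have hmul := Nat.mul_le_mul_right (n i) hle
    have hz := eq_zero_of_factorizationHom_eq_zero hpos
      (u := Function.update b i 0) (by omega)
    rw [hz, map_zero, add_zero] at hsum
    have hba : b i = a i := Nat.eq_of_mul_eq_mul_right (hpos i) hsum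
    rw [hz, add_zero, hba] at hsplit
    exact hne (ha.trans hsplit.symm)
  have hle : leastMultiplier n i ≤ a i - b i := by
    refine leastMultiplier_le (by omega) ((mem_closure_image_ne_iff n i _).mpr
      ⟨Function.update b i 0, by simp, ?_⟩)
    rw [Nat.sub_mul]
    omega
  have : leastMultiplier n i = a i := by omega
  rw [this, hdai]

lemma IsPresentation.modEq_of_factorizationHom_eq [Nontrivial ι] (hpos : ∀ i, 0 < n i)
    (h : IsPresentation n σ) (hd : ∀ u v, (u, v) ∈ σ → factorizationHom n u = d)
    {u v : ι → ℕ} (huv : factorizationHom n u = factorizationHom n v) (i : ι) :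
    u i ≡ v i [MOD leastMultiplier n i] := by
  have hc := h.leastMultiplier_mul_eq hpos hd
  -- If `a i > 0`, removing one copy of `i` leaves value `d - n i < d`, where `c i - 1` copies of
  -- `i` are the only factorization.
  have hfib : ∀ a : ι → ℕ, factorizationHom n a = d →
      ∀ i, a i ≡ 0 [MOD leastMultiplier n i] := by
    intro a ha i
    rcases Nat.eq_zero_or_pos (a i) with h0 | h0
    · rw [h0]
    have hci := (leastMultiplier_mem hpos i).1
    have hsplit : a = (a - Pi.single i 1) + Pi.single i 1 := by
      funext j
      by_cases hj : j = i
      · subst hj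
        simp only [Pi.add_apply, Pi.sub_apply, Pi.single_eq_same]
        omega
      · simp [hj]
    have h1 : factorizationHom n (a - Pi.single i 1) + n i = d := by
      rw [← ha]
      conv_rhs => rw [hsplit]
      rw [map_add, factorizationHom_single, one_mul]
    have h2 : factorizationHom n (Pi.single i (leastMultiplier n i - 1)) + n i = d := by
      rw [factorizationHom_single, ← Nat.succ_mul, Nat.succ_eq_add_one, Nat.sub_add_cancel hci,
        hc i]
    have hni := hpos i
    have heq := h.factorizationHom_injOn_lt hd
      (u := a - Pi.single i 1) (v := Pi.single i (leastMultiplier n i - 1)) (by omega) (by omega)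
    have := congrFun heq i
    simp only [Pi.sub_apply, Pi.single_eq_same] at this
    have hai : a i = leastMultiplier n i := by omega
    rw [hai]
    exact (Nat.modEq_zero_iff_dvd).mpr dvd_rfl
  exact h.rel_of_le (coordModAddCon (leastMultiplier n))
    (fun a b hab i => (hfib a (hd a b hab) i).trans
      (hfib b ((h.factorizationHom_eq hab).symm.trans (hd a b hab)) i).symm) huv i

end HomogeneousPresentation

lemma IsNumericalSemigroup.exists_consecutive {S : AddSubmonoid ℕ}
    (hS : IsNumericalSemigroup S) : ∃ x, x ∈ S ∧ x + 1 ∈ S := by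
  obtain ⟨N, hN⟩ := hS.bddAbove
  have hmem : ∀ x, N < x → x ∈ S := fun x hx => by
    by_contra hxS
    exact absurd (hN (show x ∈ (S : Set ℕ)ᶜ from hxS)) (by omega)
  exact ⟨N + 1, hmem _ (by omega), hmem _ (by omega)⟩

/-! ### Coprime products -/

section Products

variable {ι : Type*} [Fintype ι] [DecidableEq ι] {n : ι → ℕ}

/-- If `c i * n i` does not depend on `i`, and the coordinates of a factorization are determined
modulo the `c i` by its value, then `n` is of coprime product form with factors `c`. -/
lemma isCoprimeProductForm_of_modEq [Nonempty ι] {S : AddSubmonoid ℕ}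
    (hS : IsNumericalSemigroup S) (hn : AddSubmonoid.closure (Set.range n) = S)
    {c : ι → ℕ} (hc : ∀ i, 1 < c i) {d : ℕ} (hd : ∀ i, c i * n i = d)
    (hmod : ∀ u v, factorizationHom n u = factorizationHom n v → ∀ i, u i ≡ v i [MOD c i]) :
    IsCoprimeProductForm n c := by
  obtain ⟨x, hx, hx1⟩ := hS.exists_consecutive
  rw [← hn, mem_closure_range_iff_exists_factorizationHom] at hx hx1
  obtain ⟨u, hu⟩ := hx
  obtain ⟨v, hv⟩ := hx1
  -- `v - u` is an integer factorization of 1; compare two factorizations of `n j * (x + 1) = n j *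
  -- x + n j`.
  have hkey : ∀ i j, (n j : ZMod (c i)) * ((v i : ZMod (c i)) - u i) =
      if i = j then 1 else 0 := by
    intro i j
    have h := hmod (n j • v) (n j • u + Pi.single j 1) (by
      rw [map_add, map_nsmul, map_nsmul, factorizationHom_single, hu, hv]
      simp only [smul_eq_mul]
      ring) i
    rw [← ZMod.natCast_eq_natCast_iff] at h
    simp only [Pi.smul_apply, Pi.add_apply, smul_eq_mul, Pi.single_apply] at h
    push_cast at h
    rw [mul_sub, h]
    ring
  have hcop : ∀ i, Nat.Coprime (n i) (c i) := by
    intro i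
    rw [← ZMod.isUnit_iff_coprime]
    exact IsUnit.of_mul_eq_one _ (by rw [hkey i i, if_pos rfl])
  have hdvd : ∀ i j, i ≠ j → c i ∣ n j := by
    intro i j hij
    rw [← ZMod.natCast_eq_zero_iff]
    have h1 := hkey i i
    have h2 := hkey i j
    rw [if_pos rfl] at h1
    rw [if_neg hij] at h2
    calc (n j : ZMod (c i)) = n j * (n i * ((v i : ZMod (c i)) - u i)) := by rw [h1, mul_one]
      _ = n i * (n j * ((v i : ZMod (c i)) - u i)) := by ring
      _ = 0 := by rw [h2, mul_zero]
  have hpair : ∀ i j, i ≠ j → Nat.Coprime (c i) (c j) := fun i j hij =>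
    Nat.Coprime.coprime_dvd_left (hdvd i j hij) (hcop j)
  have hprod : ∀ i, ∏ j ∈ Finset.univ.erase i, c j ∣ n i := fun i =>
    Finset.prod_dvd_of_isRelPrime (fun j _ k _ hjk => Nat.coprime_iff_isRelPrime.mp (hpair j k hjk))
      (fun j hj => hdvd j i (Finset.ne_of_mem_erase hj))
  choose m hm using hprod
  have hP : 0 < ∏ j, c j := Finset.prod_pos fun j _ => by have := hc j; omega
  have hdm : ∀ i, d = (∏ j, c j) * m i := fun i => by
    rw [← hd i, ← Finset.mul_prod_erase Finset.univ c (Finset.mem_univ i), mul_assoc, ← hm i]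
  obtain ⟨i₀⟩ := ‹Nonempty ι›
  have hmm : ∀ i, m i = m i₀ := fun i =>
    Nat.eq_of_mul_eq_mul_left hP ((hdm i).symm.trans (hdm i₀))
  -- The common cofactor divides every element of `S`, in particular two consecutive ones.
  have hall : ∀ w, m i₀ ∣ factorizationHom n w := fun w => by
    rw [factorizationHom_apply]
    refine Finset.dvd_sum fun i _ => Dvd.dvd.mul_left ?_ _
    rw [← hmm i]
    exact Dvd.intro_left _ (hm i).symm
  have hone : m i₀ = 1 := by
    have h1 := hall u
    have h2 := hall v
    rw [hu] at h1
    rw [hv] at h2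
    exact Nat.dvd_one.mp ((Nat.dvd_add_right h1).mp h2)
  exact ⟨hc, hpair, fun i => by rw [hm i, hmm i, hone, mul_one]⟩

variable {k : ι → ℕ}

lemma IsCoprimeProductForm.mul_eq (hk : IsCoprimeProductForm n k) (i : ι) :
    k i * n i = ∏ j, k j := by
  rw [hk.2.2 i, Finset.mul_prod_erase _ _ (Finset.mem_univ i)]

lemma IsCoprimeProductForm.pos (hk : IsCoprimeProductForm n k) (i : ι) : 0 < n i := by
  rw [hk.2.2 i]
  exact Finset.prod_pos fun j _ => by have := hk.1 j; omega

lemma IsCoprimeProductForm.prod_pos (hk : IsCoprimeProductForm n k) : 0 < ∏ j, k j :=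
  Finset.prod_pos fun j _ => by have := hk.1 j; omega

/-- Modulo `k i` every other generator vanishes, while `n i` is invertible. -/
lemma IsCoprimeProductForm.modEq (hk : IsCoprimeProductForm n k) {u v : ι → ℕ}
    (huv : factorizationHom n u = factorizationHom n v) (i : ι) : u i ≡ v i [MOD k i] := by
  have hred : ∀ w : ι → ℕ, factorizationHom n w ≡ w i * n i [MOD k i] := by
    intro w
    rw [factorizationHom_apply, ← Finset.add_sum_erase _ _ (Finset.mem_univ i)]
    have hz : ∑ j ∈ Finset.univ.erase i, w j * n j ≡ 0 [MOD k i] := by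
      rw [Nat.modEq_zero_iff_dvd]
      refine Finset.dvd_sum fun j hj => Dvd.dvd.mul_left ?_ _
      rw [hk.2.2 j]
      exact Finset.dvd_prod_of_mem k
        (Finset.mem_erase.mpr ⟨(Finset.ne_of_mem_erase hj).symm, Finset.mem_univ i⟩)
    simpa using (Nat.ModEq.refl (w i * n i)).add hz
  have hcop : Nat.Coprime (k i) (n i) := by
    rw [hk.2.2 i]
    exact Nat.Coprime.prod_right fun j hj => hk.2.1 i j (Finset.ne_of_mem_erase hj).symm
  refine Nat.ModEq.cancel_right_of_coprime hcop ?_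
  calc u i * n i ≡ factorizationHom n u [MOD k i] := (hred u).symm
    _ ≡ v i * n i [MOD k i] := by rw [huv]; exact hred v

lemma IsCoprimeProductForm.leastMultiplier_eq [Nontrivial ι] (hk : IsCoprimeProductForm n k)
    (i : ι) : k i = leastMultiplier n i := by
  refine le_antisymm ?_ ?_
  · obtain ⟨h0, h⟩ := leastMultiplier_mem hk.pos i
    obtain ⟨u, hui, hu⟩ := (mem_closure_image_ne_iff n i _).mp h
    rw [← factorizationHom_single] at hu
    have hm := hk.modEq hu.symm i
    rw [Pi.single_eq_same, hui] at hm
    exact Nat.le_of_dvd h0 (Nat.modEq_zero_iff_dvd.mp hm)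
  · obtain ⟨j, hj⟩ := exists_ne i
    refine leastMultiplier_le (by have := hk.1 i; omega) ?_
    rw [hk.mul_eq i, ← hk.mul_eq j, ← smul_eq_mul]
    exact AddSubmonoid.nsmul_mem _ (AddSubmonoid.subset_closure (Set.mem_image_of_mem n hj)) _

lemma IsCoprimeProductForm.factorizationHom_eq_add (hk : IsCoprimeProductForm n k)
    (u : ι → ℕ) : factorizationHom n u =
      factorizationHom n (fun i => u i % k i) + (∑ i, u i / k i) * ∏ j, k j := by
  rw [factorizationHom_apply, factorizationHom_apply, Finset.sum_mul, ← Finset.sum_add_distrib]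
  refine Finset.sum_congr rfl fun i _ => ?_
  rw [← hk.mul_eq i]
  conv_lhs => rw [← Nat.mod_add_div (u i) (k i)]
  ring

lemma IsCoprimeProductForm.sum_div_eq (hk : IsCoprimeProductForm n k) {u v : ι → ℕ}
    (huv : factorizationHom n u = factorizationHom n v) :
    (fun i => u i % k i) = (fun i => v i % k i) ∧ ∑ i, u i / k i = ∑ i, v i / k i := by
  have hmod : (fun i => u i % k i) = (fun i => v i % k i) := funext fun i => hk.modEq huv i
  refine ⟨hmod, Nat.eq_of_mul_eq_mul_right hk.prod_pos ?_⟩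
  rw [hk.factorizationHom_eq_add u, hk.factorizationHom_eq_add v, hmod] at huv
  omega

lemma IsCoprimeProductForm.factorizationHom_injOn_lt (hk : IsCoprimeProductForm n k)
    {u v : ι → ℕ} (huv : factorizationHom n u = factorizationHom n v)
    (hu : factorizationHom n u < ∏ j, k j) : u = v := by
  have hlt : ∀ w : ι → ℕ, factorizationHom n w < ∏ j, k j → ∀ i, w i % k i = w i := by
    intro w hw i
    refine Nat.mod_eq_of_lt (Nat.lt_of_mul_lt_mul_right (a := n i) ?_)
    rw [hk.mul_eq i]
    exact (mul_le_factorizationHom n w i).trans_lt hw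
  funext i
  rw [← hlt u hu i, ← hlt v (huv ▸ hu) i]
  exact hk.modEq huv i

/-- A congruence identifying all the `k i • e i` identifies all factorizations of each element. -/
lemma IsCoprimeProductForm.rel_of_rel_single (hk : IsCoprimeProductForm n k)
    (C : AddCon (ι → ℕ)) (i₀ : ι) (hC : ∀ i, C (Pi.single i₀ (k i₀)) (Pi.single i (k i)))
    {u v : ι → ℕ} (huv : factorizationHom n u = factorizationHom n v) : C u v := by
  -- All batches share one class modulo `C`, so only the residues and the number of batches matter.
  have hnormal : ∀ w : ι → ℕ, C.mk' w = C.mk' (fun i => w i % k i) +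
      (∑ i, w i / k i) • C.mk' (Pi.single i₀ (k i₀)) := by
    intro w
    have hw : w = (fun i => w i % k i) + ∑ i, (w i / k i) • Pi.single i (k i) := by
      funext j
      rw [Pi.add_apply, Finset.sum_apply, Finset.sum_eq_single j]
      · simp [Nat.mod_add_div']
      · intro i _ hij
        simp [hij.symm]
      · simp
    conv_lhs => rw [hw]
    rw [map_add, map_sum, Finset.sum_smul]
    congr 1
    refine Finset.sum_congr rfl fun i _ => ?_
    rw [map_nsmul]
    congr 1
    exact (C.eq.mpr (hC i)).symm
  obtain ⟨h1, h2⟩ := hk.sum_div_eq huv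
  refine C.eq.mp ?_
  change C.mk' u = C.mk' v
  rw [hnormal u, hnormal v, h1, h2]

/-- Equality of values, together with the congruence `C` in the fibre over `d`. -/
def fiberAddCon {ι : Type*} [Fintype ι] {n : ι → ℕ} (d : ℕ)
    (hinj : ∀ u v : ι → ℕ, factorizationHom n u = factorizationHom n v →
      factorizationHom n u < d → u = v) (C : AddCon (ι → ℕ)) : AddCon (ι → ℕ) where
  r u v := factorizationHom n u = factorizationHom n v ∧ (factorizationHom n u = d → C u v)
  iseqv := ⟨fun u => ⟨rfl, fun _ => C.refl u⟩,
    fun h => ⟨h.1.symm, fun hd => C.symm (h.2 (h.1.trans hd))⟩,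
    fun h h' => ⟨h.1.trans h'.1, fun hd => C.trans (h.2 hd) (h'.2 (h.1.symm.trans hd))⟩⟩
  add' := by
    rintro u v u' v' ⟨h, hC⟩ ⟨h', hC'⟩
    refine ⟨by rw [map_add, map_add, h, h'], fun hd => ?_⟩
    rw [map_add] at hd
    -- Summands of a vector of value `d` have value at most `d`; below `d`, equal values already
    -- mean equal vectors.
    have hrel : ∀ {a b : ι → ℕ}, factorizationHom n a = factorizationHom n b →
        (factorizationHom n a = d → C a b) → factorizationHom n a ≤ d → C a b := by
      intro a b hab hCab hle
      rcases hle.lt_or_eq with hlt | heq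
      · rw [hinj a b hab hlt]
        exact C.refl b
      · exact hCab heq
    exact C.add (hrel h hC (by omega)) (hrel h' hC' (by omega))

lemma IsCoprimeProductForm.factorizationHom_single_eq (hk : IsCoprimeProductForm n k) (i : ι) :
    factorizationHom n (Pi.single i (k i)) = ∏ j, k j := by
  rw [factorizationHom_single, hk.mul_eq]

/-- The relations in the fibre over `∏ j, k j` of a presentation already form a presentation. -/
lemma IsCoprimeProductForm.isPresentation_sep [Nonempty ι] (hk : IsCoprimeProductForm n k)
    {σ : Set ((ι → ℕ) × (ι → ℕ))} (hσ : IsPresentation n σ) :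
    IsPresentation n {r ∈ σ | factorizationHom n r.1 = ∏ j, k j} := by
  obtain ⟨i₀⟩ := ‹Nonempty ι›
  refine le_antisymm (AddCon.addConGen_le.mpr fun u v huv =>
    (AddCon.ker_rel _).mpr (hσ.factorizationHom_eq huv.1)) fun u v huv => ?_
  refine hk.rel_of_rel_single _ i₀ (fun i => ?_) ((AddCon.ker_rel _).mp huv)
  have hrel := hσ.rel_of_le
    (fiberAddCon (∏ j, k j) (fun _ _ => hk.factorizationHom_injOn_lt)
      (addConGen fun u v => (u, v) ∈ {r ∈ σ | factorizationHom n r.1 = ∏ j, k j}))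
    (fun a b hab => ⟨hσ.factorizationHom_eq hab, fun hP => AddConGen.Rel.of _ _ ⟨hab, hP⟩⟩)
    (u := Pi.single i₀ (k i₀)) (v := Pi.single i (k i))
    (by rw [hk.factorizationHom_single_eq, hk.factorizationHom_single_eq])
  exact hrel.2 (hk.factorizationHom_single_eq i₀)

lemma IsCoprimeProductForm.isPresentation_range (hk : IsCoprimeProductForm n k) (i₀ : ι) :
    IsPresentation n
      (Set.range fun i => ((Pi.single i₀ (k i₀) : ι → ℕ), (Pi.single i (k i) : ι → ℕ))) := by
  refine le_antisymm (AddCon.addConGen_le.mpr ?_) fun u v huv =>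
    hk.rel_of_rel_single _ i₀ (fun i => AddConGen.Rel.of _ _ ⟨i, rfl⟩) ((AddCon.ker_rel _).mp huv)
  rintro u v ⟨i, hi⟩
  obtain ⟨rfl, rfl⟩ := Prod.mk.inj hi
  rw [AddCon.ker_rel, hk.factorizationHom_single_eq, hk.factorizationHom_single_eq]

/-- A relation outside the fibre over `∏ j, k j` could be discarded, against minimality. Attainment
comes from pruning the finite presentation by batch exchanges, which stays nonempty because two
distinct batches have equal value. -/
lemma IsCoprimeProductForm.bettiElements_eq [Nontrivial ι] (hk : IsCoprimeProductForm n k) :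
    bettiElements n = {∏ j, k j} := by
  refine Set.Subset.antisymm ?_ ?_
  · rintro _ ⟨σ, ⟨hσ, hmin⟩, u, v, huv, rfl⟩
    by_contra hne
    exact hmin {r ∈ σ | factorizationHom n r.1 = ∏ j, k j}
      ⟨fun r hr => hr.1, fun hsub => hne (hsub huv).2⟩ (hk.isPresentation_sep hσ)
  · rintro _ rfl
    obtain ⟨i₀, i₁, h01⟩ := exists_pair_ne ι
    obtain ⟨τ, hτ, hmin⟩ := exists_isMinimalPresentation_subset (Set.finite_range _)
      (hk.isPresentation_range i₀)
    have hne : (Pi.single i₀ (k i₀) : ι → ℕ) ≠ Pi.single i₁ (k i₁) := fun he => by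
      have := congrFun he i₀
      rw [Pi.single_eq_same, Pi.single_eq_of_ne h01] at this
      have := hk.1 i₀
      omega
    obtain ⟨a, b, -, hab, -, -⟩ := hmin.1.exists_relation
      (by rw [hk.factorizationHom_single_eq, hk.factorizationHom_single_eq]) hne
    obtain ⟨u, v, huv⟩ : ∃ u v, (u, v) ∈ τ := hab.elim (fun h => ⟨a, b, h⟩) fun h => ⟨b, a, h⟩
    refine ⟨τ, hmin, u, v, huv, ?_⟩
    obtain ⟨i, hi⟩ := hτ huv
    rw [← (Prod.mk.inj hi).1, hk.factorizationHom_single_eq]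

end Products

theorem mainTheorem4 (S : AddSubmonoid ℕ) (hS : IsNumericalSemigroup S)
    (p : ℕ) (hp : 2 ≤ p) (n : Fin p → ℕ) (hn : IsMinimallyGeneratedBy S n) :
    ((∃ d : ℕ, bettiElements n = {d}) ↔ ∃ k : Fin p → ℕ, IsCoprimeProductForm n k) ∧
    (∀ k : Fin p → ℕ, IsCoprimeProductForm n k →
      (∀ i, k i = leastMultiplier n i) ∧
      (∀ i, bettiElements n = {leastMultiplier n i * n i}) ∧
      bettiElements n = {b | ∃ i, b = leastMultiplier n i * n i}) := by
  have : Nontrivial (Fin p) := Fin.nontrivial_iff_two_le.mpr hp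
  refine ⟨⟨?_, fun ⟨k, hk⟩ => ⟨_, hk.bettiElements_eq⟩⟩, fun k hk => ?_⟩
  · rintro ⟨d, hd⟩
    obtain ⟨σ, hσ, -⟩ : d ∈ bettiElements n := hd ▸ Set.mem_singleton d
    have hσd : ∀ u v, (u, v) ∈ σ → factorizationHom n u = d := fun u v huv => by
      have hmem : factorizationHom n u ∈ bettiElements n := ⟨σ, hσ, u, v, huv, rfl⟩
      rwa [hd] at hmem
    exact ⟨leastMultiplier n, isCoprimeProductForm_of_modEq hS hn.closure_range
      hn.one_lt_leastMultiplier (hσ.1.leastMultiplier_mul_eq hn.pos hσd)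
      fun u v huv => hσ.1.modEq_of_factorizationHom_eq hn.pos hσd huv⟩
  · have hval : ∀ i, leastMultiplier n i * n i = ∏ j, k j := fun i => by
      rw [← hk.leastMultiplier_eq i, hk.mul_eq i]
    refine ⟨hk.leastMultiplier_eq, fun i => by rw [hk.bettiElements_eq, hval i], ?_⟩
    rw [hk.bettiElements_eq]
    ext b
    simp only [hval, Set.mem_singleton_iff, Set.mem_ofPred_eq]
    exact ⟨fun h => ⟨⟨0, by omega⟩, h⟩, fun ⟨_, h⟩ => h⟩
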